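/- Let $\mathcal M\subseteq\mathbb R^n$ be a smooth embedded submanifold of dimension $d$ with the Euclidean metric, let $R$ be a smooth retraction on $\mathcal M$ defined on the whole tangent bundle, and put $\mathcal T_{R_{\eta}}\xi=\frac{d}{dt}R_x(\eta+t\xi)|_{t=0}$ for $\eta,\xi\in T_x\mathcal M$. Let $F=f+g$ with $f:\mathcal M\to\mathbb R$ differentiable and $g:\mathbb R^n\to\mathbb R$, and let $x_0\in\mathcal M$. Assume: (i) $F$ is bounded below on $\mathcal M$ and $\Omega_{x_0}=\{x\in\mathcal M: F(x)\le F(x_0)\}$ is compact; (ii) $f$ is $L$-retraction-smooth in $\Omega_{x_0}$, i.e. $f(R_x(\eta))\le f(x)+\langle\operatorname{grad}f(x),\eta\rangle+\frac L2\|\eta\|^2$ whenever $x\in\Omega_{x_0}$, $\eta\in T_x\mathcal M$ and $R_x(\eta)\in\Omega_{x_0}$; (iii) $g$ is convex and Lipschitz continuous on $\mathbb R^n$; (iv) $g$ is retraction-convex on $\mathcal M$, i.e. for every $x\in\mathcal M$ and every $\xi\in T_x\mathcal M$ there is $\zeta\in T_x\mathcal M$ with $g(R_x(\eta))\ge g(R_x(\xi))+\langle\zeta,\eta-\xi\rangle$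 for all $\eta\in T_x\mathcal M$. Then there is $L_0$ such that for every $\tilde L>L_0$ there is a constant $\tilde a>0$ with the following property. For $x\in\mathcal M$ let $Q_x:\mathbb R^d\to T_x\mathcal M$ be a linear isometry onto $T_x\mathcal M$, and put $$\ell_x(\eta)=\langle\operatorname{grad}f(x),\eta\rangle+\tfrac{\tilde L}2\|\eta\|^2+g(R_x(\eta)),\qquad J_x(c)=\ell_x(Q_xc),$$ $$\tilde r_x(c)\in\operatorname*{arg\,min}_{v\in\mathbb R^d}\ \langle v,Q_x^T\operatorname{grad}f(x)+\tilde Lc\rangle+\tfrac{\tilde L}2\|\mathcal T_{R_{Q_xc}}Q_xv\|^2+g\bigl(R_x(Q_xc)+\mathcal T_{R_{Q_xc}}Q_xv\bigr).$$ Let $(\bar c_k)$ in $\mathbb R^d$ and $(x_k)$ satisfy, with $\bar\eta_k=Q_{x_k}\bar c_k$, $x_{k+1}=R_{x_k}(\bar\eta_k)$ and $J_{x_k}(\bar c_k)\le J_{x_k}(0)$ for all $k\ge0$. Let $\mathcal S$ be the set of accumulation points of $(x_k)$, and assume that $x\mapsto Q_x$ is smooth on a neighbourhood of $\mathcal S$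 in $\mathcal M$ (a parallelizable neighbourhood). Let $\tilde r_{x_k}(\bar c_k)$ be minimizers as above, let $\eta_k^*\in T_{x_k}\mathcal M$ be a stationary point of $\ell_{x_k}$ (that is, $0$ lies in its Clarke subdifferential at $\eta_k^*$), and let $\varepsilon_k>0$. Then: 1. If $\varrho\in\mathbb R$, $\psi:\mathbb R^3\to\mathbb R$ and $\|\tilde r_{x_k}(\bar c_k)\|\le\psi(\varepsilon_k,\varrho,\|\bar c_k\|)$ for all $k$, then there is an integer $\tilde K>0$ such that $\|\bar\eta_k-\eta_k^*\|\le\tilde a\,\psi(\varepsilon_k,\varrho,\|\bar\eta_k\|)$ for all $k>\tilde K$. 2. If $\|\tilde r_{x_k}(\bar c_k)\|\le\varepsilon_k^2$ for all $k$, then there is $\kappa>0$ with $\|\bar\eta_k-\eta_k^*\|\le(\kappa\varepsilon_k)^2$ for all $k$. 3. Put $\beta=(\tilde L-L)/2$ and let $L_F>0$ and $\varrho<\frac{\beta}{2L_F\tilde a}$. If $\|\tilde r_{x_k}(\bar c_k)\|\le\min(\varepsilon_k^2,\varrho\|\bar c_k\|^2)$ for all $k$, then there is an integer $\tilde K>0$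 such that $\|\bar\eta_k-\eta_k^*\|\le\min\bigl((\sqrt{\tilde a}\,\varepsilon_k)^2,\frac{\beta}{2L_F}\|\bar\eta_k\|^2\bigr)$ for all $k>\tilde K$. -/

import Mathlib

open Filter Topology
open scoped ContDiff NNReal

noncomputable section

namespace IRPG

section Manifold

variable {E : Type*} [NormedAddCommGroup E] [InnerProductSpace ℝ E]

/-- `M` is a smooth embedded submanifold of dimension `d` of the Euclidean space `E`: around each
of its points there is a smooth slice chart, that is, a diffeomorphism between open subsets of `E`
that maps `M` onto a `d`-dimensional linear subspace. -/
def IsEmbeddedSubmanifold (d : ℕ) (M : Set E) : Prop :=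
  ∀ x ∈ M, ∃ (φ : OpenPartialHomeomorph E E) (V : Submodule ℝ E),
    x ∈ φ.source ∧ ContDiffOn ℝ ∞ φ φ.source ∧ ContDiffOn ℝ ∞ φ.symm φ.target ∧
      Module.finrank ℝ V = d ∧ ∀ y ∈ φ.source, y ∈ M ↔ φ y ∈ V

/-- The tangent space `T_x M`: the velocities at `x` of smooth curves in `M` through `x`. For an
embedded submanifold these already form a linear subspace; the span only makes this part of
the type. It carries the inner product of `E`, which is the Riemannian metric. -/
def tangentSpace (M : Set E) (x : E) : Submodule ℝ E :=
  Submodule.span ℝ {v | ∃ γ : ℝ → E, ContDiffAt ℝ ∞ γ 0 ∧ (∀ᶠ t in 𝓝 (0 : ℝ), γ t ∈ M) ∧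
    γ 0 = x ∧ HasDerivAt γ v 0}

/-- The tangent bundle `TM`, as a subset of `E × E`. -/
def tangentBundle (M : Set E) : Set (E × E) :=
  {p | p.1 ∈ M ∧ p.2 ∈ tangentSpace M p.1}

/-- `R` is a (globally defined, smooth) retraction on `M`; only the values `R x η` with `x ∈ M` and
`η ∈ T_x M` matter. -/
structure IsRetraction (M : Set E) (R : E → E → E) : Prop where
  mapsTo : ∀ x ∈ M, ∀ η ∈ tangentSpace M x, R x η ∈ M
  smooth : ContDiffOn ℝ ∞ (fun p : E × E => R p.1 p.2) (tangentBundle M)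
  map_zero : ∀ x ∈ M, R x 0 = x
  hasDerivAt : ∀ x ∈ M, ∀ η ∈ tangentSpace M x, HasDerivAt (fun t : ℝ => R x (t • η)) η 0

/-- The vector transport by differentiated retraction,
`𝒯_{R_η} ξ = d/dt R_x(η + t ξ) |_{t = 0}`. -/
def diffRetraction (R : E → E → E) (x η ξ : E) : E :=
  deriv (fun t : ℝ => R x (η + t • ξ)) 0

/-- The Riemannian gradient: the unique `grad f(x) ∈ T_x M` with
`D f(x)[η] = ⟨grad f(x), η⟩` for all `η ∈ T_x M`. -/
def riemGrad [FiniteDimensional ℝ E] (M : Set E) (f : E → ℝ) (x : E) : tangentSpace M x :=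
  haveI := FiniteDimensional.complete ℝ (tangentSpace M x)
  (InnerProductSpace.toDual ℝ (tangentSpace M x)).symm
    ((fderivWithin ℝ f M x).comp (tangentSpace M x).subtypeL)

/-- `h` is `L`-retraction-smooth with respect to `R` in `N ⊆ M`. -/
def RetractionSmooth [FiniteDimensional ℝ E] (M : Set E) (R : E → E → E) (N : Set E) (L : ℝ)
    (h : E → ℝ) : Prop :=
  ∀ x ∈ N, ∀ T : Set (tangentSpace M x), (∀ η ∈ T, R x η ∈ N) →
    ∀ η ∈ T, h (R x η) ≤ h x + inner ℝ (riemGrad M h x) η + L / 2 * ‖η‖ ^ 2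

/-- `h` is retraction-convex with respect to `R` in `N ⊆ M`; the vector `ζ` is a subgradient of
`h ∘ R_x` at `ξ`. -/
def RetractionConvex (M : Set E) (R : E → E → E) (N : Set E) (h : E → ℝ) : Prop :=
  ∀ x ∈ N, ∀ T : Set (tangentSpace M x), (∀ η ∈ T, R x η ∈ N) →
    ∀ ξ ∈ T, ∃ ζ : tangentSpace M x, ∀ η ∈ T, h (R x η) ≥ h (R x ξ) + inner ℝ ζ (η - ξ)

/-- The accumulation points in `M` of a sequence. -/
def accPoints (M : Set E) (x : ℕ → E) : Set E :=
  {p | p ∈ M ∧ MapClusterPt p atTop x}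

/-- `Q` is a field of orthonormal bases: for `x ∈ M`, `Q x` is a linear isometry of `ℝ^d`
onto `T_x M`. -/
def IsFrame {d : ℕ} (M : Set E) (Q : E → EuclideanSpace ℝ (Fin d) →ₗᵢ[ℝ] E) : Prop :=
  ∀ x ∈ M, LinearMap.range (Q x).toLinearMap = tangentSpace M x

/-- `U` is a parallelizable set for the frame `Q`: `Q` is smooth in `U`. -/
def IsParallelizable {d : ℕ} (Q : E → EuclideanSpace ℝ (Fin d) →ₗᵢ[ℝ] E) (U : Set E) : Prop :=
  ContDiffOn ℝ ∞ (fun x => (Q x).toContinuousLinearMap) U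

end Manifold

section Clarke

variable {T : Type*} [NormedAddCommGroup T] [InnerProductSpace ℝ T]

/-- Clarke's generalized directional derivative
`h°(η; v) = limsup_{ξ → η, t ↓ 0} (h(ξ + t v) - h(ξ)) / t`. -/
def clarkeDeriv (h : T → ℝ) (η v : T) : EReal :=
  limsup (fun p : T × ℝ => (((h (p.1 + p.2 • v) - h p.1) / p.2 : ℝ) : EReal))
    (𝓝 η ×ˢ 𝓝[>] (0 : ℝ))

/-- Clarke's generalized subdifferential. -/
def clarkeSubdiff (h : T → ℝ) (η : T) : Set T :=
  {ζ | ∀ v : T, ((inner ℝ ζ v : ℝ) : EReal) ≤ clarkeDeriv h η v}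

end Clarke

section Algorithm

variable {E : Type*} [NormedAddCommGroup E] [InnerProductSpace ℝ E] [FiniteDimensional ℝ E]

/-- The model `ℓ_x(η) = ⟨grad f(x), η⟩ + (L̃/2) ‖η‖² + g(R_x(η))` on `T_x M`. -/
def proxModel (M : Set E) (R : E → E → E) (f g : E → ℝ) (Lt : ℝ) (x : E)
    (η : tangentSpace M x) : ℝ :=
  inner ℝ (riemGrad M f x) η + Lt / 2 * ‖η‖ ^ 2 + g (R x η)

/-- The same model in the coordinates of the frame,
`J_x(c) = ⟨Q_xᵀ grad f(x), c⟩ + (L̃/2) ‖c‖² + g(R_x(Q_x c))` on `ℝ^d`. -/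
def proxModelCoord {d : ℕ} (M : Set E) (R : E → E → E) (f g : E → ℝ) (Lt : ℝ)
    (Q : E → EuclideanSpace ℝ (Fin d) →ₗᵢ[ℝ] E) (x : E) (c : EuclideanSpace ℝ (Fin d)) : ℝ :=
  inner ℝ (riemGrad M f x : E) (Q x c) + Lt / 2 * ‖c‖ ^ 2 + g (R x (Q x c))

/-- The linearized model
`w̃_{x,c}(v) = ⟨v, Q_xᵀ grad f(x) + L̃ c⟩ + (L̃/2) ‖𝒯 Q_x v‖² + g(y + 𝒯 Q_x v)`, where
`y = R_x(Q_x c)` and `𝒯 = 𝒯_{R_{Q_x c}}`. -/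
def linModel {d : ℕ} (M : Set E) (R : E → E → E) (f g : E → ℝ) (Lt : ℝ)
    (Q : E → EuclideanSpace ℝ (Fin d) →ₗᵢ[ℝ] E) (x : E) (c v : EuclideanSpace ℝ (Fin d)) : ℝ :=
  inner ℝ (Q x v) ((riemGrad M f x : E) + Lt • Q x c)
    + Lt / 2 * ‖diffRetraction R x (Q x c) (Q x v)‖ ^ 2
    + g (R x (Q x c) + diffRetraction R x (Q x c) (Q x v))

/-- `v` is a value of the residual map: `v = r̃_x(c)` minimizes the linearized model over `ℝ^d`. -/
def IsLinResidual {d : ℕ} (M : Set E) (R : E → E → E) (f g : E → ℝ) (Lt : ℝ)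
    (Q : E → EuclideanSpace ℝ (Fin d) →ₗᵢ[ℝ] E) (x : E) (c v : EuclideanSpace ℝ (Fin d)) : Prop :=
  IsMinOn (linModel M R f g Lt Q x c) Set.univ v

/-- `x` is the sequence of iterates started at `x₀` with the search directions
`Q_{x_k} c_k`, each of which does not increase the proximal model. -/
structure IsIterates {d : ℕ} (M : Set E) (R : E → E → E) (f g : E → ℝ) (Lt : ℝ)
    (Q : E → EuclideanSpace ℝ (Fin d) →ₗᵢ[ℝ] E) (x₀ : E) (x : ℕ → E)
    (c : ℕ → EuclideanSpace ℝ (Fin d)) : Prop where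
  init : x 0 = x₀
  step : ∀ k, x (k + 1) = R (x k) (Q (x k) (c k))
  descent : ∀ k, proxModelCoord M R f g Lt Q (x k) (c k) ≤ proxModelCoord M R f g Lt Q (x k) 0

end Algorithm

end IRPG

end

set_option maxSynthPendingDepth 3

/-! Everything follows from one estimate ‖η̄_k − η_k*‖ ≤ a ‖r̃_k‖, valid for every k.

Since g ∘ R_x is convex, so is ℓ_x, and its Clarke stationary point u is a global minimizer. Write c
for the current direction, e = u − c, A = DR_x(c), and r for the residual. Test the optimality of r
in the linearized model at e, that of u in ℓ_x at c + r, and add. The linear terms cancel. Replacing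
R_x(c + v) by R_x(c) + Av at v = e and v = r costs second-order errors, which for L̃ large are at
most (L̃/2)(‖e‖² + ‖r‖²). When ‖r‖ ≤ ‖e‖, what remains bounds ‖e‖² by a multiple of ‖e‖‖r‖
(`norm_sub_le_of_residual`).

The constants must be uniform in k. Steps that do not increase the model stay in the compact
sublevel set (`IsIterates.mem_sublevel`). There grad f is bounded
(`RetractionSmooth.exists_norm_riemGrad_le`), so c and u lie in the unit ball for L̃ large
(`norm_le_of_proxModel_le`). The disc bundle over that set is compact, which bounds the first two
fibre derivatives of R (`IsRetraction.exists_norm_fderiv_le`). -/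

namespace IRPG

/-! ### Convex optimality conditions and the residual estimate -/

section Convex

variable {V : Type*} [NormedAddCommGroup V] [InnerProductSpace ℝ V]

/-- A function with a subgradient at every point is convex. -/
theorem convexOn_of_forall_subgradient {h : V → ℝ}
    (hs : ∀ ξ, ∃ ζ : V, ∀ η, h η ≥ h ξ + inner ℝ ζ (η - ξ)) : ConvexOn ℝ Set.univ h := by
  refine ⟨convex_univ, fun x _ y _ a b ha hb hab => ?_⟩
  obtain ⟨ζ, hζ⟩ := hs (a • x + b • y)
  have hx := mul_le_mul_of_nonneg_left (hζ x) ha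
  have hy := mul_le_mul_of_nonneg_left (hζ y) hb
  have hz : a * inner ℝ ζ (x - (a • x + b • y)) + b * inner ℝ ζ (y - (a • x + b • y)) = 0 := by
    rw [← inner_smul_right, ← inner_smul_right, ← inner_add_right]
    have : a • (x - (a • x + b • y)) + b • (y - (a • x + b • y)) =
        (a • x + b • y) - (a + b) • (a • x + b • y) := by module
    rw [this, hab, one_smul, sub_self, inner_zero_right]
  have hm : a * h (a • x + b • y) + b * h (a • x + b • y) = h (a • x + b • y) := by
    rw [← add_mul, hab, one_mul]
  simp only [smul_eq_mul]
  linarith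

/-- Convexity along a segment, written as a decrease of difference quotients. -/
theorem ConvexOn.sub_le_smul_sub {h : V → ℝ} (hc : ConvexOn ℝ Set.univ h) (x v : V) {t : ℝ}
    (h0 : 0 ≤ t) (h1 : t ≤ 1) : h (x + t • v) - h x ≤ t * (h (x + v) - h x) := by
  have := hc.2 (Set.mem_univ x) (Set.mem_univ (x + v)) (sub_nonneg.2 h1) h0 (by ring)
  have e : (1 - t) • x + t • (x + v) = x + t • v := by module
  rw [e] at this
  simp only [smul_eq_mul] at this
  linarith

/-- First-order optimality for the sum of an affine function, a quadratic form and a convex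
function. -/
theorem variational_inequality_of_isMinimizer {W : Type*} [NormedAddCommGroup W]
    [InnerProductSpace ℝ W] {φ : V → ℝ} (hφ : ConvexOn ℝ Set.univ φ) (b : V) (A : V →L[ℝ] W)
    {l : ℝ} {u : V}
    (hu : ∀ z, inner ℝ b u + l / 2 * ‖A u‖ ^ 2 + φ u ≤ inner ℝ b z + l / 2 * ‖A z‖ ^ 2 + φ z)
    (v : V) : φ u - inner ℝ b v - l * inner ℝ (A u) (A v) ≤ φ (u + v) := by
  -- Compare u with u + t v; by convexity of φ the whole inequality is divisible by t, and the term
  -- quadratic in A v vanishes as t → 0.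
  have key : ∀ t : ℝ, 0 < t → t ≤ 1 →
      0 ≤ inner ℝ b v + l * inner ℝ (A u) (A v) + l / 2 * ‖A v‖ ^ 2 * t + (φ (u + v) - φ u) := by
    intro t h0 h1
    have hm := hu (u + t • v)
    have hc := ConvexOn.sub_le_smul_sub hφ u v h0.le h1
    rw [map_add, map_smul, norm_add_sq_real, norm_smul, inner_add_right, inner_smul_right,
      inner_smul_right, Real.norm_of_nonneg h0.le] at hm
    have : 0 ≤ t * (inner ℝ b v + l * inner ℝ (A u) (A v) + l / 2 * ‖A v‖ ^ 2 * t
        + (φ (u + v) - φ u)) := by nlinarith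
    exact nonneg_of_mul_nonneg_right this h0
  have hlim : Tendsto (fun t : ℝ => inner ℝ b v + l * inner ℝ (A u) (A v)
      + l / 2 * ‖A v‖ ^ 2 * t + (φ (u + v) - φ u)) (𝓝[>] 0)
      (𝓝 (inner ℝ b v + l * inner ℝ (A u) (A v) + l / 2 * ‖A v‖ ^ 2 * 0 + (φ (u + v) - φ u))) :=
    (Continuous.tendsto (by fun_prop) 0).mono_left nhdsWithin_le_nhds
  have h := ge_of_tendsto hlim (by
    filter_upwards [Ioo_mem_nhdsGT (zero_lt_one (α := ℝ))] with t ht using key t ht.1 ht.2.le)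
  linarith

/-- A Clarke stationary point of a continuous convex function is a global minimizer. -/
theorem isMinimizer_of_zero_mem_clarkeSubdiff {h : V → ℝ} (hc : ConvexOn ℝ Set.univ h)
    (hcont : Continuous h) {η : V} (h0 : 0 ∈ clarkeSubdiff h η) (z : V) : h η ≤ h z := by
  obtain ⟨v, rfl⟩ : ∃ v, z = η + v := ⟨z - η, by abel⟩
  refine le_of_forall_pos_le_add fun δ hδ => ?_
  have hlim : Tendsto (fun ξ => h (ξ + v) - h ξ) (𝓝 η) (𝓝 (h (η + v) - h η)) :=
    Continuous.tendsto (by fun_prop) η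
  -- For t ≤ 1 convexity bounds the quotient at ξ by the full increment h(ξ + v) − h(ξ), which is
  -- continuous in ξ; so the Clarke derivative is at most h(η + v) − h(η) + δ.
  have hev : ∀ᶠ p : V × ℝ in 𝓝 η ×ˢ 𝓝[>] (0 : ℝ),
      (((h (p.1 + p.2 • v) - h p.1) / p.2 : ℝ) : EReal) ≤ ((h (η + v) - h η + δ : ℝ) : EReal) := by
    filter_upwards [(hlim.eventually_lt_const (lt_add_of_pos_right _ hδ)).prod_mk
      (Ioo_mem_nhdsGT (zero_lt_one (α := ℝ)))] with p hp
    rw [EReal.coe_le_coe_iff, div_le_iff₀ hp.2.1]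
    have := ConvexOn.sub_le_smul_sub hc p.1 v hp.2.1.le hp.2.2.le
    have := mul_le_mul_of_nonneg_left hp.1.le hp.2.1.le
    linarith
  have := (h0 v).trans (limsup_le_of_le (h := hev))
  rw [inner_zero_left, EReal.coe_le_coe_iff] at this
  linarith

/-- The distance of `c` to the minimizer `u` of the composite model is controlled by the
residual `r` of the linearized model at `c`. -/
theorem norm_sub_le_of_residual {E : Type*} [NormedAddCommGroup E] [InnerProductSpace ℝ E]
    {G : V → E} {g : E → ℝ} (hg : ConvexOn ℝ Set.univ g) {Lg : ℝ≥0} (hLg : LipschitzWith Lg g)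
    (hgG : ConvexOn ℝ Set.univ fun v => g (G v)) {b c u r : V} {A : V →L[ℝ] E} {l B C : ℝ}
    (hl : 0 < l) (hC : 2 * (Lg * C) ≤ l) (hA : ‖A‖ ≤ B)
    (hG : ∀ v, ‖v‖ ≤ 2 → ‖G (c + v) - G c - A v‖ ≤ C * ‖v‖ ^ 2)
    (hcu : ‖u - c‖ ≤ 2)
    (hu : ∀ z, inner ℝ b u + l / 2 * ‖u‖ ^ 2 + g (G u) ≤
      inner ℝ b z + l / 2 * ‖z‖ ^ 2 + g (G z))
    (hr : ∀ z, inner ℝ (b + l • c) r + l / 2 * ‖A r‖ ^ 2 + g (G c + A r) ≤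
      inner ℝ (b + l • c) z + l / 2 * ‖A z‖ ^ 2 + g (G c + A z)) :
    ‖u - c‖ ≤ (2 * (1 + B ^ 2) + 1) * ‖r‖ := by
  set e := u - c with he
  have hr0 := norm_nonneg r
  have he0 := norm_nonneg e
  -- The constant is at least 1, which settles the first case. In the second, ‖r‖ ≤ ‖e‖ ≤ 2, so the
  -- Taylor bound applies at both e and r.
  rcases le_total ‖e‖ ‖r‖ with her | hre
  · nlinarith [mul_nonneg (sq_nonneg B) hr0]
  have hB : 0 ≤ B := (norm_nonneg A).trans hA
  have hφ : ConvexOn ℝ Set.univ fun v => g (G c + A v) := by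
    refine ⟨convex_univ, fun x _ y _ s t hs ht hst => ?_⟩
    have := hg.2 (Set.mem_univ (G c + A x)) (Set.mem_univ (G c + A y)) hs ht hst
    have e1 : s • (G c + A x) + t • (G c + A y) = G c + A (s • x + t • y) := by
      rw [map_add, map_smul, map_smul, smul_add, smul_add]
      conv_rhs => rw [← one_smul ℝ (G c), ← hst, add_smul]
      abel
    rwa [e1] at this
  have hLip : ∀ v, ‖v‖ ≤ 2 → |g (G (c + v)) - g (G c + A v)| ≤ Lg * C * ‖v‖ ^ 2 := by
    intro v hv
    have h1 := hLg.dist_le_mul (G (c + v)) (G c + A v)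
    rw [Real.dist_eq, dist_eq_norm, ← sub_sub] at h1
    have := mul_le_mul_of_nonneg_left (hG v hv) Lg.coe_nonneg
    linarith
  have h1 := variational_inequality_of_isMinimizer hφ (b + l • c) A hr (e - r)
  have h2 := variational_inequality_of_isMinimizer hgG b (ContinuousLinearMap.id ℝ V) hu (r - e)
  simp only [ContinuousLinearMap.id_apply] at h2
  have e1 : r + (e - r) = e := by abel
  have e2 : u + (r - e) = c + r := by rw [he]; abel
  have e3 : c + e = u := by rw [he]; abel
  rw [e1] at h1
  rw [e2] at h2
  have h3 := (abs_le.1 (hLip e hcu)).1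
  have h4 := (abs_le.1 (hLip r (hre.trans hcu))).2
  rw [e3] at h3
  have i1 : inner ℝ (b + l • c) (e - r) = inner ℝ b (e - r) + l * inner ℝ c (e - r) := by
    rw [inner_add_left, real_inner_smul_left]
  have i2 : inner ℝ b (r - e) = - inner ℝ b (e - r) := by rw [← inner_neg_right, neg_sub]
  have i3 : inner ℝ u (r - e) = - inner ℝ c (e - r) - ‖e‖ ^ 2 + inner ℝ e r := by
    rw [← e3, inner_add_left, inner_sub_right e, real_inner_self_eq_norm_sq, ← neg_sub e r,
      inner_neg_right]
    ring
  have i4 : inner ℝ (A r) (A (e - r)) = inner ℝ (A r) (A e) - ‖A r‖ ^ 2 := by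
    rw [map_sub, inner_sub_right, real_inner_self_eq_norm_sq]
  have i5 : inner ℝ (A r) (A e) ≤ B ^ 2 * (‖e‖ * ‖r‖) := by
    calc inner ℝ (A r) (A e) ≤ ‖A r‖ * ‖A e‖ := real_inner_le_norm _ _
      _ ≤ (B * ‖r‖) * (B * ‖e‖) := by
          gcongr
          · exact A.le_of_opNorm_le hA r
          · exact A.le_of_opNorm_le hA e
      _ = _ := by ring
  have i6 : inner ℝ e r ≤ ‖e‖ * ‖r‖ := real_inner_le_norm _ _
  rw [i1, i4] at h1
  rw [i2, i3] at h2
  -- Sum of the two variational inequalities. Both sides end up proportional to l, so the final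
  -- constant does not depend on l.
  have main : l * (‖e‖ ^ 2 - inner ℝ e r - inner ℝ (A r) (A e) + ‖A r‖ ^ 2) ≤
      Lg * C * (‖e‖ ^ 2 + ‖r‖ ^ 2) := by nlinarith
  have main2 : Lg * C * (‖e‖ ^ 2 + ‖r‖ ^ 2) ≤ l / 2 * (‖e‖ ^ 2 + ‖r‖ ^ 2) := by
    gcongr
    linarith
  have main3 : ‖e‖ ^ 2 - inner ℝ e r - inner ℝ (A r) (A e) + ‖A r‖ ^ 2 ≤
      (‖e‖ ^ 2 + ‖r‖ ^ 2) / 2 := by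
    refine le_of_mul_le_mul_left (a := l) ?_ hl
    linarith
  have main4 : ‖e‖ * ‖e‖ ≤ ‖e‖ * ((2 * (1 + B ^ 2) + 1) * ‖r‖) := by
    nlinarith [sq_nonneg ‖A r‖, mul_le_mul_of_nonneg_right hre hr0]
  rcases he0.eq_or_lt with h | h
  · rw [← h]; positivity
  · exact le_of_mul_le_mul_left main4 h

end Convex

/-! ### Tangent spaces in slice charts and compact disc bundles -/

section Tangent

variable {E : Type*} [NormedAddCommGroup E] [InnerProductSpace ℝ E] [FiniteDimensional ℝ E]

/-- The derivative at a point of a curve that stays in a subspace belongs to that subspace. -/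
theorem mem_of_hasDerivAt_of_eventually_mem {V : Submodule ℝ E} {γ : ℝ → E} {v : E}
    (hγ : HasDerivAt γ v 0) (hV : ∀ᶠ t in 𝓝 (0 : ℝ), γ t ∈ V) : v ∈ V := by
  have hcl : IsClosed (V : Set E) := V.closed_of_finiteDimensional
  refine hcl.mem_of_tendsto hγ.tendsto_slope_zero ?_
  filter_upwards [nhdsWithin_le_nhds hV] with t ht
  rw [zero_add]
  exact V.smul_mem _ (V.sub_mem ht hV.self_of_nhds)

/-- The tangent space in terms of a slice chart. -/
theorem tangentSpace_eq_comap {M : Set E} {φ : OpenPartialHomeomorph E E} {V : Submodule ℝ E}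
    (hφ : ContDiffOn ℝ ∞ φ φ.source) (hφs : ContDiffOn ℝ ∞ φ.symm φ.target)
    (hV : ∀ y ∈ φ.source, y ∈ M ↔ φ y ∈ V) {x : E} (hx : x ∈ φ.source) (hxM : x ∈ M) :
    tangentSpace M x = V.comap (fderiv ℝ φ x : E →ₗ[ℝ] E) := by
  have hd : HasFDerivAt φ (fderiv ℝ φ x) x :=
    ((hφ.contDiffAt (φ.open_source.mem_nhds hx)).differentiableAt (by simp)).hasFDerivAt
  have hcs : ContDiffAt ℝ ∞ φ.symm (φ x) :=
    hφs.contDiffAt (φ.open_target.mem_nhds (φ.map_source hx))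
  have hds : HasFDerivAt φ.symm (fderiv ℝ φ.symm (φ x)) (φ x) :=
    (hcs.differentiableAt (by simp)).hasFDerivAt
  apply le_antisymm
  · rw [tangentSpace, Submodule.span_le]
    rintro v ⟨γ, -, hγM, rfl, hγ⟩
    refine mem_of_hasDerivAt_of_eventually_mem (γ := φ ∘ γ) (v := fderiv ℝ φ (γ 0) v)
      (hd.comp_hasDerivAt (0 : ℝ) hγ) ?_
    filter_upwards [hγM, hγ.continuousAt.eventually (φ.open_source.mem_nhds hx)] with t h1 h2
    exact (hV _ h2).1 h1
  · intro v hv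
    have hinv : fderiv ℝ φ.symm (φ x) (fderiv ℝ φ x v) = v := by
      have h1 := hds.comp x hd
      have h2 : HasFDerivAt (φ.symm ∘ φ) (ContinuousLinearMap.id ℝ E) x :=
        (hasFDerivAt_id x).congr_of_eventuallyEq (φ.eventually_left_inverse hx)
      exact DFunLike.congr_fun (h1.unique h2) v
    -- This line stays in V, so its pullback by the chart is a curve in M with velocity v at x.
    have hl : HasDerivAt (fun t : ℝ => φ x + t • fderiv ℝ φ x v) (fderiv ℝ φ x v) 0 := by
      simpa using ((hasDerivAt_id (0 : ℝ)).smul_const (fderiv ℝ φ x v)).const_add (φ x)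
    have hl0 : φ x + (0 : ℝ) • fderiv ℝ φ x v = φ x := by simp
    refine Submodule.subset_span
      ⟨fun t => φ.symm (φ x + t • fderiv ℝ φ x v), ?_, ?_, ?_, ?_⟩
    · refine ContDiffAt.comp (0 : ℝ) (by rwa [hl0]) ?_
      fun_prop
    · have : ∀ᶠ t in 𝓝 (0 : ℝ), φ x + t • fderiv ℝ φ x v ∈ φ.target :=
        hl.continuousAt.eventually (by
          beta_reduce; rw [hl0]; exact φ.open_target.mem_nhds (φ.map_source hx))
      filter_upwards [this] with t ht
      rw [hV _ (φ.map_target ht), φ.right_inv ht]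
      exact V.add_mem ((hV x hx).1 hxM) (V.smul_mem _ hv)
    · simp [φ.left_inv hx]
    · have := HasFDerivAt.comp_hasDerivAt (l := φ.symm) (0 : ℝ) (by rwa [hl0]) hl
      rwa [hinv] at this

/-- Limits of tangent vectors are tangent vectors, provided the base points converge in `M`. -/
theorem mem_tangentBundle_of_tendsto {d : ℕ} {M : Set E} (hM : IsEmbeddedSubmanifold d M)
    {p : E × E} (hp : p.1 ∈ M) {q : ℕ → E × E} (hq : ∀ n, q n ∈ tangentBundle M)
    (hlim : Tendsto q atTop (𝓝 p)) : p ∈ tangentBundle M := by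
  obtain ⟨φ, V, hx, hφ, hφs, -, hV⟩ := hM p.1 hp
  refine ⟨hp, ?_⟩
  rw [tangentSpace_eq_comap hφ hφs hV hx hp]
  have h1 : Tendsto (fun n => (q n).1) atTop (𝓝 p.1) := (continuous_fst.tendsto p).comp hlim
  have h2 : Tendsto (fun n => (q n).2) atTop (𝓝 p.2) := (continuous_snd.tendsto p).comp hlim
  have hcont : ContinuousAt (fderiv ℝ φ) p.1 :=
    (hφ.contDiffAt (φ.open_source.mem_nhds hx)).continuousAt_fderiv (by simp)
  have hcl : IsClosed (V : Set E) := V.closed_of_finiteDimensional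
  -- In the chart, tangency is the closed condition Dφ(x) v ∈ V, and Dφ is continuous.
  have hlim' : Tendsto (fun n => fderiv ℝ φ (q n).1 (q n).2) atTop (𝓝 (fderiv ℝ φ p.1 p.2)) :=
    (isBoundedBilinearMap_apply.continuous.tendsto (fderiv ℝ φ p.1, p.2)).comp
      ((hcont.tendsto.comp h1).prodMk_nhds h2)
  refine hcl.mem_of_tendsto hlim' ?_
  filter_upwards [h1.eventually (φ.open_source.mem_nhds hx)] with n hn
  have := (hq n).2
  rwa [tangentSpace_eq_comap hφ hφs hV hn (hq n).1] at this

/-- The closed disc bundle over a compact subset of `M` is compact. -/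
theorem isCompact_discBundle {d : ℕ} {M : Set E} (hM : IsEmbeddedSubmanifold d M) {N : Set E}
    (hN : IsCompact N) (hNM : N ⊆ M) (ρ : ℝ) :
    IsCompact {p : E × E | p.1 ∈ N ∧ p.2 ∈ tangentSpace M p.1 ∧ ‖p.2‖ ≤ ρ} := by
  have hK : IsCompact (N ×ˢ Metric.closedBall (0 : E) ρ) := hN.prod (isCompact_closedBall 0 ρ)
  refine hK.of_isClosed_subset (isClosed_of_closure_subset fun p hp => ?_)
    fun p hp => ⟨hp.1, mem_closedBall_zero_iff.2 hp.2.2⟩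
  obtain ⟨q, hq, hlim⟩ := mem_closure_iff_seq_limit.1 hp
  have hpK : p ∈ N ×ˢ Metric.closedBall (0 : E) ρ :=
    hK.isClosed.mem_of_tendsto hlim
      (Eventually.of_forall fun n => ⟨(hq n).1, mem_closedBall_zero_iff.2 (hq n).2.2⟩)
  exact ⟨hpK.1, (mem_tangentBundle_of_tendsto hM (hNM hpK.1)
    (fun n => ⟨hNM (hq n).1, (hq n).2.1⟩) hlim).2, mem_closedBall_zero_iff.1 hpK.2⟩

end Tangent

/-! ### Uniform bounds on fibre derivatives of the retraction -/

section Retraction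

variable {E : Type*} [NormedAddCommGroup E] [InnerProductSpace ℝ E]

theorem IsRetraction.contDiff {M : Set E} {R : E → E → E} (hR : IsRetraction M R) {x : E}
    (hx : x ∈ M) : ContDiff ℝ ∞ fun η : tangentSpace M x => R x η := by
  rw [← contDiffOn_univ]
  have hinc : ContDiff ℝ ∞ fun η : tangentSpace M x => (x, (η : E)) :=
    contDiff_const.prodMk (tangentSpace M x).subtypeL.contDiff
  exact hR.smooth.comp hinc.contDiffOn fun η _ => ⟨hx, η.2⟩

/-- By the chain rule, as R_x is differentiable on the whole tangent space. It makes the transport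
linear in ξ, hence the linearized model convex. -/
theorem IsRetraction.diffRetraction_eq_fderiv {M : Set E} {R : E → E → E}
    (hR : IsRetraction M R) {x : E} (hx : x ∈ M) (η ξ : tangentSpace M x) :
    diffRetraction R x η ξ = fderiv ℝ (fun η : tangentSpace M x => R x η) η ξ := by
  have hd : HasFDerivAt (fun η : tangentSpace M x => R x η)
      (fderiv ℝ (fun η : tangentSpace M x => R x η) η) η :=
    ((hR.contDiff hx).differentiable (by simp) η).hasFDerivAt
  have hl : HasDerivAt (fun t : ℝ => η + t • ξ) ξ 0 := by
    simpa using ((hasDerivAt_id (0 : ℝ)).smul_const ξ).const_add η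
  exact (HasFDerivAt.comp_hasDerivAt (0 : ℝ) (by simpa using hd) hl).deriv

/-- Near a tangent vector, the first two derivatives of a retraction along the fibres are
bounded. -/
theorem IsRetraction.exists_nhdsWithin_norm_fderiv_le {M : Set E} {R : E → E → E}
    (hR : IsRetraction M R) {p : E × E} (hp : p ∈ tangentBundle M) :
    ∃ t ∈ 𝓝[tangentBundle M] p, ∃ C : ℝ, ∀ x ∈ M, ∀ η : tangentSpace M x, (x, (η : E)) ∈ t →
      ‖fderiv ℝ (fun η : tangentSpace M x => R x η) η‖ ≤ C ∧
      ‖fderiv ℝ (fderiv ℝ (fun η : tangentSpace M x => R x η)) η‖ ≤ C := by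
  have hs : ContDiffWithinAt ℝ (1 + 1) (fun q : E × E => R q.1 q.2) (tangentBundle M) p :=
    (hR.smooth p hp).of_le (by norm_num; exact WithTop.coe_le_coe.2 le_top)
  -- Derivatives within the bundle need not be unique; f₁ and f₂ are choices continuous at p, hence
  -- bounded nearby.
  obtain ⟨u₁, hu₁, -, -, f₁, hf', hs'⟩ :=
    (contDiffWithinAt_succ_iff_hasFDerivWithinAt' (by simp)).1 hs
  obtain ⟨u₂, hu₂, -, -, f₂, hf₂, hs₂⟩ :=
    (contDiffWithinAt_succ_iff_hasFDerivWithinAt' (n := 0) (by simp)).1 (by simpa using hs')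
  rw [Set.insert_eq_of_mem hp] at hu₁ hu₂
  have hb' : ∀ᶠ q in 𝓝[tangentBundle M] p, ‖f₁ q‖ < ‖f₁ p‖ + 1 :=
    hs'.continuousWithinAt.norm.eventually_lt_const (lt_add_one _)
  have hb₂ : ∀ᶠ q in 𝓝[tangentBundle M] p, ‖f₂ q‖ < ‖f₂ p‖ + 1 :=
    hs₂.continuousWithinAt.norm.eventually_lt_const (lt_add_one _)
  -- The first condition makes the formula for the fibre derivative hold near η, so that it can be
  -- differentiated again.
  refine ⟨{q | (∀ᶠ z in 𝓝[tangentBundle M] q, z ∈ u₁) ∧ q ∈ u₁ ∧ q ∈ u₂ ∧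
      ‖f₁ q‖ < ‖f₁ p‖ + 1 ∧ ‖f₂ q‖ < ‖f₂ p‖ + 1}, ?_, max (‖f₁ p‖ + 1) (‖f₂ p‖ + 1), ?_⟩
  · filter_upwards [eventually_eventually_nhdsWithin.2 hu₁, hu₁, hu₂, hb', hb₂]
      with q h1 h2 h3 h4 h5 using ⟨h1, h2, h3, h4, h5⟩
  rintro x hx η ⟨hev, h1, h2, h3, h4⟩
  -- Vertical inclusion of the fibre. The fibre lies entirely in the bundle, so composing with it
  -- turns derivatives within the bundle into ordinary ones.
  set J : tangentSpace M x →L[ℝ] E × E :=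
    (ContinuousLinearMap.inr ℝ E E).comp (tangentSpace M x).subtypeL with hJ
  have hJn : ‖J‖ ≤ 1 := by
    refine J.opNorm_le_bound zero_le_one fun v => ?_
    simp [hJ]
  have hι : ∀ η : tangentSpace M x,
      HasFDerivAt (fun η : tangentSpace M x => (x, (η : E))) J η := fun η =>
    (hasFDerivAt_const x η).prodMk (tangentSpace M x).subtypeL.hasFDerivAt
  have hmem : ∀ η : tangentSpace M x, (x, (η : E)) ∈ tangentBundle M := fun η => ⟨hx, η.2⟩
  have hfd : ∀ η : tangentSpace M x, (x, (η : E)) ∈ u₁ →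
      fderiv ℝ (fun η : tangentSpace M x => R x η) η = (f₁ (x, η)).comp J := fun η hη =>
    (HasFDerivWithinAt.comp_hasFDerivAt (g := fun q : E × E => R q.1 q.2) η (hf' _ hη) (hι η)
      (Eventually.of_forall hmem)).fderiv
  have hev' : ∀ᶠ η' : tangentSpace M x in 𝓝 η, (x, (η' : E)) ∈ u₁ :=
    (tendsto_nhdsWithin_iff.2 ⟨(hι η).continuousAt, Eventually.of_forall hmem⟩).eventually hev
  have hfd2 : HasFDerivAt (fderiv ℝ (fun η : tangentSpace M x => R x η))
      (((ContinuousLinearMap.compL ℝ (tangentSpace M x) (E × E) E).flip J).comp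
        ((f₂ (x, η)).comp J)) η := by
    have h5 := (hf₂ _ h2).comp_hasFDerivAt η (hι η) (Eventually.of_forall hmem)
    have h6 := ((ContinuousLinearMap.compL ℝ (tangentSpace M x) (E × E) E).flip J).hasFDerivAt.comp
      η h5
    refine h6.congr_of_eventuallyEq ?_
    filter_upwards [hev'] with η' hη'
    rw [hfd η' hη']
    rfl
  constructor
  · rw [hfd η h1]
    calc ‖(f₁ (x, η)).comp J‖ ≤ ‖f₁ (x, η)‖ * ‖J‖ := ContinuousLinearMap.opNorm_comp_le _ _
      _ ≤ ‖f₁ (x, η)‖ * 1 := by gcongr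
      _ ≤ _ := by rw [mul_one]; exact h3.le.trans (le_max_left _ _)
  · rw [hfd2.fderiv]
    refine le_trans (ContinuousLinearMap.opNorm_le_bound _ (norm_nonneg (f₂ (x, η))) fun v => ?_)
      (h4.le.trans (le_max_right _ _))
    calc ‖(f₂ (x, η) (J v)).comp J‖ ≤ ‖f₂ (x, η) (J v)‖ * ‖J‖ :=
          ContinuousLinearMap.opNorm_comp_le _ _
      _ ≤ (‖f₂ (x, η)‖ * (1 * ‖v‖)) * 1 := by
          gcongr
          exact (f₂ (x, η)).le_opNorm_of_le (J.le_of_opNorm_le hJn v)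
      _ = _ := by ring

/-- The first two derivatives of a retraction along the fibres are bounded on closed disc
bundles over compact sets. -/
theorem IsRetraction.exists_norm_fderiv_le [FiniteDimensional ℝ E] {d : ℕ} {M : Set E}
    (hM : IsEmbeddedSubmanifold d M) {R : E → E → E} (hR : IsRetraction M R) {N : Set E}
    (hN : IsCompact N) (hNM : N ⊆ M) (ρ : ℝ) :
    ∃ C : ℝ, 0 ≤ C ∧ ∀ x ∈ N, ∀ η : tangentSpace M x, ‖η‖ ≤ ρ →
      ‖fderiv ℝ (fun η : tangentSpace M x => R x η) η‖ ≤ C ∧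
      ‖fderiv ℝ (fderiv ℝ (fun η : tangentSpace M x => R x η)) η‖ ≤ C := by
  have key := (isCompact_discBundle hM hN hNM ρ).induction_on
    (p := fun t => ∃ C : ℝ, ∀ x ∈ M, ∀ η : tangentSpace M x, (x, (η : E)) ∈ t →
      ‖fderiv ℝ (fun η : tangentSpace M x => R x η) η‖ ≤ C ∧
      ‖fderiv ℝ (fderiv ℝ (fun η : tangentSpace M x => R x η)) η‖ ≤ C)
    ⟨0, fun _ _ _ h => h.elim⟩
    (fun s t hst ⟨C, hC⟩ => ⟨C, fun x hx η h => hC x hx η (hst h)⟩)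
    (fun s t ⟨C, hC⟩ ⟨C', hC'⟩ => ⟨max C C', fun x hx η h => h.elim
      (fun h => ⟨(hC x hx η h).1.trans (le_max_left _ _), (hC x hx η h).2.trans (le_max_left _ _)⟩)
      (fun h => ⟨(hC' x hx η h).1.trans (le_max_right _ _),
        (hC' x hx η h).2.trans (le_max_right _ _)⟩)⟩)
    (fun p hp => by
      obtain ⟨t, ht, C, hC⟩ := hR.exists_nhdsWithin_norm_fderiv_le (p := p) ⟨hNM hp.1, hp.2.1⟩
      have hsub : {p : E × E | p.1 ∈ N ∧ p.2 ∈ tangentSpace M p.1 ∧ ‖p.2‖ ≤ ρ} ⊆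
          tangentBundle M := fun q hq => ⟨hNM hq.1, hq.2.1⟩
      exact ⟨t, nhdsWithin_mono p hsub ht, C, hC⟩)
  obtain ⟨C, hC⟩ := key
  refine ⟨max C 0, le_max_right _ _, fun x hx η hη => ?_⟩
  have := hC x (hNM hx) η ⟨hx, η.2, hη⟩
  exact ⟨this.1.trans (le_max_left _ _), this.2.trans (le_max_left _ _)⟩

/-- A first-order Taylor estimate from a bound on the second derivative in a ball. -/
theorem norm_sub_sub_fderiv_le {V W : Type*} [NormedAddCommGroup V] [NormedSpace ℝ V]
    [NormedAddCommGroup W] [NormedSpace ℝ W] {G : V → W} (hG : ContDiff ℝ 2 G) {C ρ : ℝ}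
    (hC : ∀ η, ‖η‖ ≤ ρ → ‖fderiv ℝ (fderiv ℝ G) η‖ ≤ C) {η v : V}
    (hη : ‖η‖ + ‖v‖ ≤ ρ) : ‖G (η + v) - G η - fderiv ℝ G η v‖ ≤ C * ‖v‖ ^ 2 := by
  have hd : Differentiable ℝ G := hG.differentiable (by simp)
  have hd2 : Differentiable ℝ (fderiv ℝ G) :=
    (hG.fderiv_right (m := 1) (by norm_num)).differentiable (by simp)
  have hball : ∀ z ∈ Metric.closedBall η ‖v‖, ‖z‖ ≤ ρ := fun z hz => by
    have := norm_le_norm_add_norm_sub' z η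
    rw [← dist_eq_norm] at this
    linarith [Metric.mem_closedBall.1 hz]
  have hη' : η ∈ Metric.closedBall η ‖v‖ := Metric.mem_closedBall_self (norm_nonneg v)
  have hC0 : 0 ≤ C := (norm_nonneg (fderiv ℝ (fderiv ℝ G) η)).trans (hC η (hball η hη'))
  have h := (convex_closedBall η ‖v‖).norm_image_sub_le_of_norm_fderiv_le' (𝕜 := ℝ) (f := G)
    (φ := fderiv ℝ G η) (C := C * ‖v‖) (x := η) (y := η + v) (fun z _ => hd z)
    (fun z hz => ?_) hη' (by simp)
  · rw [add_sub_cancel_left] at h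
    linarith
  · refine ((convex_closedBall η ‖v‖).norm_image_sub_le_of_norm_fderiv_le (𝕜 := ℝ)
      (fun z _ => hd2 z) (fun z hz => hC z (hball z hz)) hη' hz).trans ?_
    rw [← dist_eq_norm]
    exact mul_le_mul_of_nonneg_left (Metric.mem_closedBall.1 hz) hC0

end Retraction

/-! ### Staying in the sublevel set, gradient bound, short steps -/

section Descent

variable {E : Type*} [NormedAddCommGroup E] [InnerProductSpace ℝ E]

theorem RetractionConvex.convexOn {M : Set E} {R : E → E → E} (hR : IsRetraction M R) {g : E → ℝ}
    (hg : RetractionConvex M R M g) {x : E} (hx : x ∈ M) :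
    ConvexOn ℝ Set.univ fun η : tangentSpace M x => g (R x η) :=
  convexOn_of_forall_subgradient fun ξ => by
    obtain ⟨ζ, hζ⟩ := hg x hx Set.univ (fun η _ => hR.mapsTo x hx η η.2) ξ (Set.mem_univ ξ)
    exact ⟨ζ, fun η => hζ η (Set.mem_univ η)⟩

/-- Along a retraction, a Lipschitz retraction-convex function decreases at most linearly. -/
theorem RetractionConvex.sub_le {M : Set E} {R : E → E → E} (hR : IsRetraction M R) {g : E → ℝ}
    (hg : RetractionConvex M R M g) {Lg : ℝ≥0} (hLg : LipschitzWith Lg g) {x : E} (hx : x ∈ M)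
    (η : tangentSpace M x) : g x - Lg * ‖η‖ ≤ g (R x η) := by
  obtain ⟨ζ, hζ⟩ := hg x hx Set.univ (fun η _ => hR.mapsTo x hx η η.2) 0 (Set.mem_univ 0)
  have hζ' : ∀ η : tangentSpace M x, g x + inner ℝ ζ η ≤ g (R x η) := fun η => by
    simpa [hR.map_zero x hx] using hζ η (Set.mem_univ η)
  -- Test the subgradient at tζ, divide by t and let t ↓ 0, using DR_x(0) = id.
  have hbound : ‖ζ‖ ^ 2 ≤ Lg * ‖ζ‖ := by
    have hd := (hR.hasDerivAt x hx ζ ζ.2).tendsto_slope_zero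
    have hd' := ((hd.mono_left (nhdsGT_le_nhdsNE 0)).norm).const_mul (Lg : ℝ)
    refine ge_of_tendsto hd' ?_
    filter_upwards [self_mem_nhdsWithin] with t ht
    have ht : 0 < t := ht
    have h1 := hζ' (t • ζ)
    rw [inner_smul_right, real_inner_self_eq_norm_sq] at h1
    have h2 := (le_abs_self _).trans ((hLg.dist_le_mul (R x (t • ζ : tangentSpace M x)) x))
    rw [dist_eq_norm] at h2
    simp only [zero_add, zero_smul, hR.map_zero x hx, norm_smul, norm_inv, Real.norm_eq_abs,
      abs_of_pos ht]
    have h3 : t * ‖ζ‖ ^ 2 ≤ Lg * ‖R x (t • (ζ : E)) - x‖ := by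
      simp only [Submodule.coe_smul] at h1 h2
      linarith
    calc ‖ζ‖ ^ 2 = t⁻¹ * (t * ‖ζ‖ ^ 2) := by field_simp
      _ ≤ t⁻¹ * (Lg * ‖R x (t • (ζ : E)) - x‖) := by gcongr
      _ = _ := by ring
  have hnorm : ‖ζ‖ ≤ Lg := by
    rcases (norm_nonneg ζ).eq_or_lt with h | h
    · rw [← h]; exact Lg.coe_nonneg
    · nlinarith
  have h1 := (abs_le.1 (abs_real_inner_le_norm ζ η)).1
  have h2 := mul_le_mul_of_nonneg_right hnorm (norm_nonneg η)
  linarith [hζ' η]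

variable [FiniteDimensional ℝ E]

theorem inner_riemGrad (M : Set E) (f : E → ℝ) (x : E) (η : tangentSpace M x) :
    inner ℝ (riemGrad M f x) η = fderivWithin ℝ f M x η := by
  have := FiniteDimensional.complete ℝ (tangentSpace M x)
  rw [riemGrad, InnerProductSpace.toDual_symm_apply]
  rfl

theorem RetractionSmooth.le {M : Set E} {R : E → E → E} {N : Set E} {L : ℝ} {h : E → ℝ}
    (hh : RetractionSmooth M R N L h) {x : E} (hx : x ∈ N) (η : tangentSpace M x)
    (hη : R x η ∈ N) : h (R x η) ≤ h x + inner ℝ (riemGrad M h x) η + L / 2 * ‖η‖ ^ 2 :=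
  hh x hx {η} (by rintro _ rfl; exact hη) η rfl

/-- Serves to replace L by `max L 0`, since the sublevel-set arguments need a nonnegative constant.
-/
theorem RetractionSmooth.mono {M : Set E} {R : E → E → E} {N : Set E} {L L' : ℝ} {h : E → ℝ}
    (hh : RetractionSmooth M R N L h) (hL : L ≤ L') : RetractionSmooth M R N L' h := by
  intro x hx T hT η hη
  have := hh x hx T hT η hη
  have : L / 2 * ‖η‖ ^ 2 ≤ L' / 2 * ‖η‖ ^ 2 := by gcongr
  linarith

/-- A retraction curve along which the quadratic upper model of `f + g` decreases linearly does
not leave the sublevel set in which `f` is retraction-smooth. -/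
theorem RetractionSmooth.mem_sublevel {M : Set E} {R : E → E → E} (hR : IsRetraction M R)
    {f g : E → ℝ} (hf : DifferentiableOn ℝ f M) (hg : Continuous g) {α L : ℝ} (hL0 : 0 ≤ L)
    (hL : RetractionSmooth M R {y | y ∈ M ∧ f y + g y ≤ α} L f) {x : E} (hx : x ∈ M)
    (hxα : f x + g x ≤ α) (η : tangentSpace M x) {δ : ℝ} (hδ : 0 < δ)
    (hdec : ∀ s : ℝ, 0 ≤ s → s ≤ 1 → s * inner ℝ (riemGrad M f x) η + L / 2 * (s * ‖η‖) ^ 2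
      + g (R x (s • (η : E))) ≤ g x - δ * s) :
    R x η ∈ M ∧ f (R x η) + g (R x η) ≤ α := by
  set σ : ℝ → E := fun s => R x (s • (η : E)) with hσ
  have hσM : ∀ s, σ s ∈ M := fun s =>
    hR.mapsTo x hx _ ((tangentSpace M x).smul_mem s η.2)
  have hσ0 : σ 0 = x := by simp [hσ, hR.map_zero x hx]
  have hσc : Continuous σ := by
    have : Continuous fun s : ℝ => (fun η : tangentSpace M x => R x η) (s • η) :=
      (hR.contDiff hx).continuous.comp (by fun_prop)
    exact this
  have hfσ : Continuous fun s => f (σ s) := hf.continuousOn.comp_continuous hσc hσM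
  have hFσ : Continuous fun s => f (σ s) + g (σ s) := hfσ.add (hg.comp hσc)
  -- Retraction-smoothness is available only at points already known to lie in the sublevel set.
  -- There it yields a strict inequality, which propagates by continuity along [0, 1]; strictness
  -- may fail at s = 0, where the derivative of f along the curve is used instead.
  have hlt : ∀ s : ℝ, 0 < s → s ≤ 1 → f (σ s) + g (σ s) ≤ α → f (σ s) + g (σ s) < α := by
    intro s h0 h1 hs
    have h2 := hL.le (x := x) ⟨hx, hxα⟩ (s • η) ⟨hσM s, hs⟩
    rw [inner_smul_right, norm_smul, Real.norm_of_nonneg h0.le] at h2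
    have h3 := hdec s h0.le h1
    have h4 := mul_pos hδ h0
    simp only [Submodule.coe_smul] at h2
    simp only [hσ]
    linarith
  have hd : HasDerivAt (fun s => f (σ s)) (inner ℝ (riemGrad M f x) η) 0 := by
    rw [inner_riemGrad]
    have h1 : HasFDerivWithinAt f (fderivWithin ℝ f M x) M (σ 0) := by
      rw [hσ0]; exact (hf x hx).hasFDerivWithinAt
    exact h1.comp_hasDerivAt 0 (hR.hasDerivAt x hx η η.2) (Eventually.of_forall hσM)
  have hIcc : Set.Icc (0 : ℝ) 1 ⊆ {s | f (σ s) + g (σ s) ≤ α} := by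
    refine IsClosed.Icc_subset_of_forall_mem_nhdsWithin
      ((isClosed_le hFσ continuous_const).inter isClosed_Icc) (by simpa [hσ0] using hxα) ?_
    rintro s ⟨hs, hs0, hs1⟩
    rcases hs0.eq_or_lt with rfl | hpos
    · have hslope := (hd.tendsto_slope_zero).mono_left (nhdsGT_le_nhdsNE 0)
      filter_upwards [hslope.eventually_lt_const (lt_add_of_pos_right _ hδ),
        Ioo_mem_nhdsGT (zero_lt_one (α := ℝ))] with t ht ht01
      have h3 := hdec t ht01.1.le ht01.2.le
      rw [zero_add, hσ0, smul_eq_mul, inv_mul_lt_iff₀ ht01.1] at ht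
      have h5 : 0 ≤ L / 2 * (t * ‖η‖) ^ 2 := by positivity
      change f (σ t) + g (σ t) ≤ α
      simp only [hσ] at ht ⊢
      linarith
    · exact mem_nhdsWithin_of_mem_nhds ((hFσ.continuousAt.eventually_lt_const
        (hlt s hpos hs1.le hs)).mono fun t ht => le_of_lt ht)
  have h1 := hIcc (Set.right_mem_Icc.2 zero_le_one)
  refine ⟨hR.mapsTo x hx η η.2, ?_⟩
  simpa [hσ] using h1

/-- The Riemannian gradient of a retraction-smooth function is bounded on a compact sublevel
set. -/
theorem RetractionSmooth.exists_norm_riemGrad_le {M : Set E} {R : E → E → E}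
    (hR : IsRetraction M R) {f g : E → ℝ} (hf : DifferentiableOn ℝ f M) {Lg : ℝ≥0}
    (hLg : LipschitzWith Lg g) {α L : ℝ} (hL0 : 0 ≤ L)
    (hcpt : IsCompact {y | y ∈ M ∧ f y + g y ≤ α})
    (hL : RetractionSmooth M R {y | y ∈ M ∧ f y + g y ≤ α} L f) {B : ℝ}
    (hB : ∀ x ∈ {y | y ∈ M ∧ f y + g y ≤ α}, ∀ η : tangentSpace M x, ‖η‖ ≤ 1 →
      ‖R x η - x‖ ≤ B * ‖η‖) :
    ∃ C : ℝ, 0 ≤ C ∧ ∀ x ∈ {y | y ∈ M ∧ f y + g y ≤ α}, ‖riemGrad M f x‖ ≤ C := by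
  obtain ⟨D, hD⟩ := hcpt.exists_bound_of_continuousOn
    (hf.continuousOn.mono fun y hy => hy.1)
  -- Beyond the first threshold, the unit step along −grad f stays in the sublevel set. It would
  -- then lower f by more than 2D beyond the second, contradicting |f| ≤ D.
  refine ⟨max 0 (max (L / 2 + Lg * B) (2 * D + L / 2)), le_max_left _ _, fun x hx => ?_⟩
  set p := riemGrad M f x with hp
  by_contra! hcon
  obtain ⟨hp0, hcon⟩ := max_lt_iff.1 hcon
  obtain ⟨hcon1, hcon2⟩ := max_lt_iff.1 hcon
  set η : tangentSpace M x := -(‖p‖⁻¹ • p) with hη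
  have hηn : ‖η‖ = 1 := by
    rw [hη, norm_neg, norm_smul, norm_inv, norm_norm, inv_mul_cancel₀ hp0.ne']
  have hpη : inner ℝ p η = -‖p‖ := by
    rw [hη, inner_neg_right, inner_smul_right, real_inner_self_eq_norm_sq]
    field_simp
  have hmem := hL.mem_sublevel hR hf hLg.continuous hL0 hx.1 hx.2 η (sub_pos.2 hcon1)
    (fun s h0 h1 => by
      have h2 := hB x hx (s • η) (by rw [norm_smul, Real.norm_of_nonneg h0, hηn]; linarith)
      rw [norm_smul, Real.norm_of_nonneg h0, hηn, mul_one] at h2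
      have h3 := (le_abs_self _).trans (hLg.dist_le_mul (R x (s • η : tangentSpace M x)) x)
      rw [dist_eq_norm] at h3
      have h4 := mul_le_mul_of_nonneg_left h2 Lg.coe_nonneg
      have h5 : L / 2 * s ^ 2 ≤ L / 2 * s := by
        have : s ^ 2 ≤ s := by nlinarith
        gcongr
      rw [← hp, hpη, hηn, mul_one]
      simp only [Submodule.coe_smul] at h3 h4
      nlinarith)
  have h1 := hL.le hx η hmem
  rw [← hp, hpη, hηn] at h1
  have h2 := (abs_le.1 (hD _ hmem)).1
  have h3 := (abs_le.1 (hD _ hx)).2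
  linarith

/-- A tangent vector at which the proximal model does not exceed its value at `0` is short. -/
theorem norm_le_of_proxModel_le {M : Set E} {R : E → E → E} (hR : IsRetraction M R) {f g : E → ℝ}
    {Lg : ℝ≥0} (hLg : LipschitzWith Lg g) (hg : RetractionConvex M R M g) {x : E} (hx : x ∈ M)
    {D l : ℝ} (hD : ‖riemGrad M f x‖ ≤ D) (hl : 2 * (D + Lg) < l) {η : tangentSpace M x}
    (hη : proxModel M R f g l x η ≤ proxModel M R f g l x 0) : ‖η‖ ≤ 1 := by
  have h1 := hg.sub_le hR hLg hx η
  have h2 := (abs_le.1 (abs_real_inner_le_norm (riemGrad M f x) η)).1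
  have h3 := mul_le_mul_of_nonneg_right hD (norm_nonneg η)
  simp only [proxModel, inner_zero_right, norm_zero, Submodule.coe_zero, hR.map_zero x hx] at hη
  by_contra! hcon
  have h4 : ‖η‖ * (l / 2 * ‖η‖) ≤ ‖η‖ * (D + Lg) := by nlinarith
  have h5 := le_of_mul_le_mul_left h4 (by linarith)
  have h6 : 0 ≤ D + Lg := add_nonneg ((norm_nonneg _).trans hD) Lg.coe_nonneg
  nlinarith

theorem proxModel_convexOn {M : Set E} {R : E → E → E} (hR : IsRetraction M R) (f : E → ℝ)
    {g : E → ℝ} (hg : RetractionConvex M R M g) {x : E} (hx : x ∈ M) {l : ℝ} (hl : 0 ≤ l) :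
    ConvexOn ℝ Set.univ (proxModel M R f g l x) := by
  have h1 : ConvexOn ℝ Set.univ fun η : tangentSpace M x => inner ℝ (riemGrad M f x) η :=
    (innerₛₗ ℝ (riemGrad M f x)).convexOn convex_univ
  have h2 : ConvexOn ℝ Set.univ fun η : tangentSpace M x => ‖η‖ ^ 2 :=
    (convexOn_univ_norm).pow (fun _ _ => norm_nonneg _) 2
  exact (h1.add (h2.smul (div_nonneg hl zero_le_two))).add (hg.convexOn hR hx)

theorem continuous_proxModel {M : Set E} {R : E → E → E} (hR : IsRetraction M R) (f : E → ℝ)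
    {g : E → ℝ} (hg : Continuous g) {x : E} (hx : x ∈ M) (l : ℝ) :
    Continuous (proxModel M R f g l x) := by
  have h1 : Continuous fun η : tangentSpace M x => g (R x η) :=
    hg.comp (hR.contDiff hx).continuous
  unfold proxModel
  exact Continuous.add (by fun_prop) h1

/-- A step that does not increase the proximal model stays in the sublevel set. -/
theorem RetractionSmooth.step_mem_sublevel {M : Set E} {R : E → E → E} (hR : IsRetraction M R)
    {f g : E → ℝ} (hf : DifferentiableOn ℝ f M) (hgc : Continuous g)
    (hg : RetractionConvex M R M g) {α L l : ℝ} (hL0 : 0 ≤ L) (hLl : L < l)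
    (hL : RetractionSmooth M R {y | y ∈ M ∧ f y + g y ≤ α} L f) {x : E} (hx : x ∈ M)
    (hxα : f x + g x ≤ α) {η : tangentSpace M x}
    (hη : proxModel M R f g l x η ≤ proxModel M R f g l x 0) :
    R x η ∈ M ∧ f (R x η) + g (R x η) ≤ α := by
  rcases eq_or_ne η 0 with rfl | hne
  · simpa [hR.map_zero x hx] using ⟨hx, hxα⟩
  have hpos : 0 < ‖η‖ ^ 2 := pow_pos (norm_pos_iff.2 hne) 2
  -- The gap l − L is the decrease left after convexity of g ∘ R_x interpolates the model descent
  -- between 0 and η, with s² ≤ s.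
  refine hL.mem_sublevel hR hf hgc hL0 hx hxα η (δ := (l - L) / 2 * ‖η‖ ^ 2)
    (mul_pos (by linarith) hpos) fun s h0 h1 => ?_
  have h2 := ConvexOn.sub_le_smul_sub (hg.convexOn hR hx) 0 η h0 h1
  simp only [proxModel, inner_zero_right, norm_zero, Submodule.coe_zero, hR.map_zero x hx] at hη
  simp only [zero_add, Submodule.coe_smul, Submodule.coe_zero, hR.map_zero x hx] at h2
  have h3 := mul_le_mul_of_nonneg_left hη h0
  have h4 : L / 2 * ‖η‖ ^ 2 * s ^ 2 ≤ L / 2 * ‖η‖ ^ 2 * s := by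
    have : s ^ 2 ≤ s := by nlinarith
    gcongr
  nlinarith

end Descent

/-! ### Uniform error bound in a frame -/

section ErrorBound

variable {E : Type*} [NormedAddCommGroup E] [InnerProductSpace ℝ E] {d : ℕ}

theorem IsFrame.mem_tangentSpace {M : Set E} {Q : E → EuclideanSpace ℝ (Fin d) →ₗᵢ[ℝ] E}
    (hQ : IsFrame M Q) {x : E} (hx : x ∈ M) (c : EuclideanSpace ℝ (Fin d)) :
    Q x c ∈ tangentSpace M x := by
  rw [← hQ x hx]
  exact ⟨c, rfl⟩

theorem IsFrame.exists_eq {M : Set E} {Q : E → EuclideanSpace ℝ (Fin d) →ₗᵢ[ℝ] E}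
    (hQ : IsFrame M Q) {x : E} (hx : x ∈ M) (η : tangentSpace M x) : ∃ c, Q x c = η :=
  (hQ x hx).ge η.2

variable [FiniteDimensional ℝ E]

theorem IsFrame.proxModel_eq {M : Set E} {Q : E → EuclideanSpace ℝ (Fin d) →ₗᵢ[ℝ] E}
    (hQ : IsFrame M Q) (R : E → E → E) (f g : E → ℝ) (l : ℝ) {x : E} (hx : x ∈ M)
    (c : EuclideanSpace ℝ (Fin d)) :
    proxModel M R f g l x ⟨Q x c, hQ.mem_tangentSpace hx c⟩ = proxModelCoord M R f g l Q x c := by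
  simp [proxModel, proxModelCoord, Submodule.coe_norm, Submodule.coe_inner]

/-- The linearized model in terms of the differential of the retraction on the tangent space. -/
theorem IsRetraction.linModel_eq {M : Set E} (Q : E → EuclideanSpace ℝ (Fin d) →ₗᵢ[ℝ] E)
    {R : E → E → E} (hR : IsRetraction M R) (f g : E → ℝ) (l : ℝ) {x : E}
    (hx : x ∈ M) (c v : EuclideanSpace ℝ (Fin d)) (η ξ : tangentSpace M x)
    (hη : Q x c = η) (hξ : Q x v = ξ) :
    linModel M R f g l Q x c v = inner ℝ (riemGrad M f x + l • η) ξ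
      + l / 2 * ‖fderiv ℝ (fun η : tangentSpace M x => R x η) η ξ‖ ^ 2
      + g (R x η + fderiv ℝ (fun η : tangentSpace M x => R x η) η ξ) := by
  rw [linModel, hη, hξ, hR.diffRetraction_eq_fderiv hx, real_inner_comm]
  rfl

/-- All iterates stay in the initial sublevel set. -/
theorem IsIterates.mem_sublevel {M : Set E} {R : E → E → E} (hR : IsRetraction M R)
    {f g : E → ℝ} (hf : DifferentiableOn ℝ f M) (hgc : Continuous g)
    (hg : RetractionConvex M R M g) {L l : ℝ} (hL0 : 0 ≤ L) (hLl : L < l) {x₀ : E} (hx₀ : x₀ ∈ M)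
    (hL : RetractionSmooth M R {y | y ∈ M ∧ f y + g y ≤ f x₀ + g x₀} L f)
    {Q : E → EuclideanSpace ℝ (Fin d) →ₗᵢ[ℝ] E} (hQ : IsFrame M Q) {x : ℕ → E}
    {c : ℕ → EuclideanSpace ℝ (Fin d)} (hit : IsIterates M R f g l Q x₀ x c) (k : ℕ) :
    x k ∈ M ∧ f (x k) + g (x k) ≤ f x₀ + g x₀ := by
  induction k with
  | zero => rw [hit.init]; exact ⟨hx₀, le_rfl⟩
  | succ k ih =>
    rw [hit.step k]
    refine hL.step_mem_sublevel hR hf hgc hg hL0 hLl ih.1 ih.2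
      (η := ⟨Q (x k) (c k), hQ.mem_tangentSpace ih.1 _⟩) ?_
    have h0 : (0 : tangentSpace M (x k)) = ⟨Q (x k) 0, hQ.mem_tangentSpace ih.1 _⟩ := by
      ext; simp
    rw [h0, hQ.proxModel_eq R f g l ih.1, hQ.proxModel_eq R f g l ih.1]
    exact hit.descent k

/-- A global error bound: for a sufficiently large proximal parameter, the distance from any
search direction to the stationary point of the proximal model is at most a uniform multiple of
the linearized residual. -/
theorem exists_error_bound {M : Set E} (hM : IsEmbeddedSubmanifold d M) {R : E → E → E}
    (hR : IsRetraction M R) {f g : E → ℝ} (hf : DifferentiableOn ℝ f M) {x₀ : E} (hx₀ : x₀ ∈ M)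
    (hcpt : IsCompact {y | y ∈ M ∧ f y + g y ≤ f x₀ + g x₀}) {L : ℝ}
    (hL : RetractionSmooth M R {y | y ∈ M ∧ f y + g y ≤ f x₀ + g x₀} L f)
    (hgconv : ConvexOn ℝ Set.univ g) {Lg : ℝ≥0} (hgLip : LipschitzWith Lg g)
    (hgR : RetractionConvex M R M g) :
    ∃ L₀ a : ℝ, 0 < a ∧ ∀ l : ℝ, L₀ < l →
      ∀ (Q : E → EuclideanSpace ℝ (Fin d) →ₗᵢ[ℝ] E) (x : ℕ → E)
        (c r : ℕ → EuclideanSpace ℝ (Fin d)) (ηstar : ∀ k, tangentSpace M (x k)),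
        IsFrame M Q → IsIterates M R f g l Q x₀ x c →
        (∀ k, IsLinResidual M R f g l Q (x k) (c k) (r k)) →
        (∀ k, 0 ∈ clarkeSubdiff (proxModel M R f g l (x k)) (ηstar k)) →
        ∀ k, ‖Q (x k) (c k) - ηstar k‖ ≤ a * ‖r k‖ := by
  have hΩM : {y | y ∈ M ∧ f y + g y ≤ f x₀ + g x₀} ⊆ M := fun y hy => hy.1
  -- Radius 3 = 1 + 2: directions have norm at most 1, and increments between two of them at most 2.
  obtain ⟨C, hC0, hC⟩ := hR.exists_norm_fderiv_le hM hcpt hΩM 3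
  have hL' := hL.mono (le_max_left L 0)
  obtain ⟨D, hD0, hD⟩ := hL'.exists_norm_riemGrad_le (B := C) hR hf hgLip (le_max_right L 0) hcpt
    fun x hx η hη => by
      have h := (convex_closedBall (0 : tangentSpace M x) 3).norm_image_sub_le_of_norm_fderiv_le
        (𝕜 := ℝ) (f := fun η : tangentSpace M x => R x η) (C := C) (x := 0) (y := η)
        (fun z _ => (hR.contDiff hx.1).differentiable (by simp) z)
        (fun z hz => (hC x hx z (mem_closedBall_zero_iff.1 hz)).1)
        (by simp) (mem_closedBall_zero_iff.2 (by linarith))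
      simpa [hR.map_zero x hx.1] using h
  -- The three thresholds respectively keep iterates in the sublevel set, absorb the linearization
  -- errors, and force c and u into the unit ball.
  refine ⟨max (max L 0) (max (2 * (Lg * C)) (2 * (D + Lg))), 2 * (1 + C ^ 2) + 1, by positivity,
    fun l hl Q x c r ηstar hQ hit hr hstar k => ?_⟩
  obtain ⟨hl1, hl⟩ := max_lt_iff.1 hl
  obtain ⟨hl2, hl3⟩ := max_lt_iff.1 hl
  have hl0 : 0 < l := (le_max_right L 0).trans_lt hl1
  have hxΩ := hit.mem_sublevel hR hf hgLip.continuous hgR (le_max_right L 0) hl1 hx₀ hL' hQ k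
  have hxM := hxΩ.1
  have hmin := isMinimizer_of_zero_mem_clarkeSubdiff (proxModel_convexOn hR f hgR hxM hl0.le)
    (continuous_proxModel hR f hgLip.continuous hxM l) (hstar k)
  set η : tangentSpace M (x k) := ⟨Q (x k) (c k), hQ.mem_tangentSpace hxM _⟩ with hη
  set ξ : tangentSpace M (x k) := ⟨Q (x k) (r k), hQ.mem_tangentSpace hxM _⟩ with hξ
  have h0 : (0 : tangentSpace M (x k)) = ⟨Q (x k) 0, hQ.mem_tangentSpace hxM _⟩ := by
    ext; simp
  have hdesc : proxModel M R f g l (x k) η ≤ proxModel M R f g l (x k) 0 := by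
    rw [h0, hQ.proxModel_eq R f g l hxM, hQ.proxModel_eq R f g l hxM]
    exact hit.descent k
  have hη1 : ‖η‖ ≤ 1 := norm_le_of_proxModel_le hR hgLip hgR hxM (hD _ hxΩ) hl3 hdesc
  have hs1 : ‖ηstar k‖ ≤ 1 :=
    norm_le_of_proxModel_le hR hgLip hgR hxM (hD _ hxΩ) hl3 (hmin 0)
  have hξn : ‖ξ‖ = ‖r k‖ := (Q (x k)).norm_map (r k)
  have hfinal := norm_sub_le_of_residual (G := fun η : tangentSpace M (x k) => R (x k) η)
    (b := riemGrad M f (x k)) (c := η) (u := ηstar k) (r := ξ)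
    (A := fderiv ℝ (fun η : tangentSpace M (x k) => R (x k) η) η) hgconv hgLip
    (hgR.convexOn hR hxM) hl0 hl2.le (hC _ hxΩ η (by linarith)).1
    (fun v hv => norm_sub_sub_fderiv_le (ρ := 3)
      ((hR.contDiff hxM).of_le (by exact WithTop.coe_le_coe.2 le_top))
      (fun z hz => (hC _ hxΩ z hz).2) (by linarith))
    ((norm_sub_le _ _).trans (by linarith)) hmin
    -- The frame is onto the tangent space, so minimality over ℝ^d is minimality over all tangent
    -- vectors.
    (fun z => by
      obtain ⟨v, hv⟩ := hQ.exists_eq hxM z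
      have := hr k (Set.mem_univ v)
      simp only [Set.mem_ofPred_eq] at this
      rwa [hR.linModel_eq Q f g l hxM (c k) v η z rfl hv,
        hR.linModel_eq Q f g l hxM (c k) (r k) η ξ rfl rfl] at this)
  rw [hξn, norm_sub_rev] at hfinal
  exact hfinal

end ErrorBound

end IRPG

/-! ### The three accuracy statements -/

theorem theorem4p2 {E : Type*} [NormedAddCommGroup E] [InnerProductSpace ℝ E]
    [FiniteDimensional ℝ E] {d : ℕ}
    (M : Set E) (hM : IRPG.IsEmbeddedSubmanifold d M)
    (R : E → E → E) (hR : IRPG.IsRetraction M R)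
    (f g : E → ℝ) (hf : DifferentiableOn ℝ f M)
    (x₀ : E) (hx₀ : x₀ ∈ M)
    -- the objective is bounded below on `M` and its sublevel set at `x₀` is compact
    (hbdd : BddBelow ((fun y => f y + g y) '' M))
    (hcpt : IsCompact {y | y ∈ M ∧ f y + g y ≤ f x₀ + g x₀})
    -- `f` is `L`-retraction-smooth in the sublevel set
    (L : ℝ) (hL : IRPG.RetractionSmooth M R {y | y ∈ M ∧ f y + g y ≤ f x₀ + g x₀} L f)
    -- `g` is convex and Lipschitz in the Euclidean sense, and retraction-convex on `M`
    (hgconv : ConvexOn ℝ Set.univ g) (Lg : NNReal) (hgLip : LipschitzWith Lg g)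
    (hgR : IRPG.RetractionConvex M R M g) :
    ∃ L₀ : ℝ, ∀ Lt : ℝ, L₀ < Lt → ∃ a : ℝ, 0 < a ∧
      ∀ (Q : E → EuclideanSpace ℝ (Fin d) →ₗᵢ[ℝ] E) (x : ℕ → E)
        (c r : ℕ → EuclideanSpace ℝ (Fin d))
        (ηstar : ∀ k, IRPG.tangentSpace M (x k)) (ε : ℕ → ℝ) (U : Set E),
        IRPG.IsFrame M Q →
        IRPG.IsIterates M R f g Lt Q x₀ x c →
        -- `U` is a parallelizable neighbourhood in `M` of the set of accumulation points
        U ⊆ M → (∃ V : Set E, IsOpen V ∧ IRPG.accPoints M x ⊆ V ∧ V ∩ M ⊆ U) →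
        IRPG.IsParallelizable Q U →
        -- `r k` is the linearized residual at `c k`, and `ηstar k` is a stationary point of the
        -- proximal model
        (∀ k, IRPG.IsLinResidual M R f g Lt Q (x k) (c k) (r k)) →
        (∀ k, 0 ∈ IRPG.clarkeSubdiff (IRPG.proxModel M R f g Lt (x k)) (ηstar k)) →
        (∀ k, 0 < ε k) →
        (∀ (ψ : ℝ → ℝ → ℝ → ℝ) (ρ : ℝ), (∀ k, ‖r k‖ ≤ ψ (ε k) ρ ‖c k‖) →
          ∃ K : ℕ, 0 < K ∧ ∀ k, K < k →
            ‖Q (x k) (c k) - ηstar k‖ ≤ a * ψ (ε k) ρ ‖Q (x k) (c k)‖) ∧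
        ((∀ k, ‖r k‖ ≤ ε k ^ 2) →
          ∃ κ : ℝ, 0 < κ ∧ ∀ k, ‖Q (x k) (c k) - ηstar k‖ ≤ (κ * ε k) ^ 2) ∧
        (∀ ρ LF : ℝ, 0 < LF → ρ < ((Lt - L) / 2) / (2 * LF * a) →
          (∀ k, ‖r k‖ ≤ min (ε k ^ 2) (ρ * ‖c k‖ ^ 2)) →
          ∃ K : ℕ, 0 < K ∧ ∀ k, K < k →
            ‖Q (x k) (c k) - ηstar k‖ ≤
              min ((√a * ε k) ^ 2) (((Lt - L) / 2) / (2 * LF) * ‖Q (x k) (c k)‖ ^ 2)) := by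
  obtain ⟨L₀, a, ha, hbound⟩ :=
    IRPG.exists_error_bound hM hR hf hx₀ hcpt hL hgconv hgLip hgR
  refine ⟨L₀, fun Lt hLt => ⟨a, ha, fun Q x c r ηstar ε U hQ hit _ _ _ hr hstar hε => ?_⟩⟩
  have key := hbound Lt hLt Q x c r ηstar hQ hit hr hstar
  -- The error bound holds from the first index on, so any positive K serves; κ = √a turns a ε² into
  -- (κ ε)².
  refine ⟨fun ψ ρ hψ => ⟨1, one_pos, fun k _ => ?_⟩,
    fun hr2 => ⟨√a, Real.sqrt_pos.2 ha, fun k => ?_⟩,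
    fun ρ LF hLF hρ hmin => ⟨1, one_pos, fun k _ => le_min ?_ ?_⟩⟩
  · rw [(Q (x k)).norm_map]
    exact (key k).trans (mul_le_mul_of_nonneg_left (hψ k) ha.le)
  · rw [mul_pow, Real.sq_sqrt ha.le]
    exact (key k).trans (mul_le_mul_of_nonneg_left (hr2 k) ha.le)
  · rw [mul_pow, Real.sq_sqrt ha.le]
    exact (key k).trans
      (mul_le_mul_of_nonneg_left ((hmin k).trans (min_le_left _ _)) ha.le)
  · rw [(Q (x k)).norm_map]
    refine (key k).trans ((mul_le_mul_of_nonneg_left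
      ((hmin k).trans (min_le_right _ _)) ha.le).trans ?_)
    rw [← mul_assoc]
    refine mul_le_mul_of_nonneg_right ?_ (sq_nonneg _)
    -- What is needed is a ρ ≤ β/(2 L_F), the upper bound on ρ cleared of a.
    rw [lt_div_iff₀ (by positivity)] at hρ
    rw [le_div_iff₀ (by positivity)]
    linarith
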